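/- Consider the commutative algebra $\mathbb R^{\mathbb R}$ of all functions $\mathbb R\to\mathbb R$ with pointwise operations; subalgebras are linear subspaces closed under multiplication and need not contain the constant function $1$. For a cardinal $\kappa$, a set $E\subset\mathbb R^{\mathbb R}$ is called \emph{$\kappa$-algebrable} if $E\cup\{0\}$ contains a $\kappa$-generated subalgebra, i.e. a subalgebra whose least cardinality of a generating set is $\kappa$; it is called \emph{strongly $\kappa$-algebrable} if $E\cup\{0\}$ contains a subalgebra generated by a set $X$ with $|X|=\kappa$ of free generators, i.e. such that $P(x_1,\dots,x_n)\neq 0$ for every nonzero real polynomial $P$ without constant term and all distinct $x_1,\dots,x_n\in X$. A function $f:\mathbb R\to\mathbb R$ is \emph{nowhere continuous} if it is continuous at no point, \emph{Darboux} if it maps connected sets to connected sets, and \emph{compact-preserving} if it maps compact sets to compact sets. Let $\mathfrak c=|\mathbb R|$. Then: (i) the family of all nowhere continuous Darboux functions $f:\mathbb R\to\mathbb R$ that map every uncountable compact set to a compact set is strongly $2^{\mathfrak c}$-algebrable; (ii) the family of all nowhere continuous compact-preserving functions $f:\mathbb R\to\mathbb R$ is $2^{\mathfrak c}$-algebrable,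 but it is not strongly $1$-algebrable. -/

import Mathlib

open Cardinal

universe u v

section Algebrability

variable {K : Type v} {A : Type u} [Field K] [CommRing A] [Algebra K A]

/-- The (not necessarily unital) subalgebra `B` is `κ`-generated: `κ` is the least cardinality
of a set of generators of `B`. -/
def IsGeneratedByCard (B : NonUnitalSubalgebra K A) (κ : Cardinal.{u}) : Prop :=
  (∃ X : Set A, #X = κ ∧ NonUnitalAlgebra.adjoin K X = B) ∧
    ∀ Y : Set A, NonUnitalAlgebra.adjoin K Y = B → κ ≤ #Y

/-- `X` is a set of free generators of the (not necessarily unital) commutative subalgebra `B`: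
`X` generates `B`, and no nonzero polynomial without constant term vanishes at the (pairwise
distinct) elements of `X`. -/
def IsFreelyGeneratedBy (B : NonUnitalSubalgebra K A) (X : Set A) : Prop :=
  NonUnitalAlgebra.adjoin K X = B ∧
    ∀ P : MvPolynomial X K, MvPolynomial.constantCoeff P = 0 →
      MvPolynomial.aeval (fun x : X => (x : A)) P = 0 → P = 0

variable (K)

/-- `E` is `κ`-algebrable: `E ∪ {0}` contains a `κ`-generated algebra. -/
def IsAlgebrable (κ : Cardinal.{u}) (E : Set A) : Prop :=
  ∃ B : NonUnitalSubalgebra K A, (B : Set A) ⊆ E ∪ {0} ∧ IsGeneratedByCard B κ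

/-- `E` is strongly `κ`-algebrable: `E ∪ {0}` contains a free algebra with `κ` free
generators. -/
def IsStronglyAlgebrable (κ : Cardinal.{u}) (E : Set A) : Prop :=
  ∃ B : NonUnitalSubalgebra K A, (B : Set A) ⊆ E ∪ {0} ∧
    ∃ X : Set A, #X = κ ∧ IsFreelyGeneratedBy B X

end Algebrability

/-- `f` has no point of continuity. -/
def NowhereContinuous (f : ℝ → ℝ) : Prop := ∀ x, ¬ ContinuousAt f x

/-- `f` maps connected sets to connected sets. -/
def IsDarboux (f : ℝ → ℝ) : Prop := ∀ C : Set ℝ, IsConnected C → IsConnected (f '' C)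

/-- `f` maps compact sets to compact sets. -/
def CompactPreserving (f : ℝ → ℝ) : Prop := ∀ C : Set ℝ, IsCompact C → IsCompact (f '' C)

/-- `f` maps uncountable compact sets to compact sets. -/
def UncountableCompactPreserving (f : ℝ → ℝ) : Prop :=
  ∀ C : Set ℝ, IsCompact C → ¬ C.Countable → IsCompact (f '' C)

open Filter Topology

section Polynomials

variable {K : Type v} {A : Type u} [Field K] [CommRing A] [Algebra K A]

/-- The difference between the value of a polynomial at elements of `X` and its constant term
lies in the nonunital algebra generated by `X`. -/
theorem aeval_sub_constantCoeff_mem_adjoin (X : Set A) (P : MvPolynomial X K) :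
    MvPolynomial.aeval (fun x : X => (x : A)) P
      - algebraMap K A (MvPolynomial.constantCoeff P) ∈ NonUnitalAlgebra.adjoin K X := by
  induction P using MvPolynomial.induction_on with
  | C a => simp
  | add p q hp hq =>
    convert add_mem hp hq using 1
    simp only [map_add]
    ring
  | mul_X p i hp =>
    have hi : (i : A) ∈ NonUnitalAlgebra.adjoin K X := NonUnitalAlgebra.subset_adjoin K i.2
    convert add_mem (mul_mem hp hi)
      (SMulMemClass.smul_mem (MvPolynomial.constantCoeff p) hi) using 1
    simp only [map_mul, MvPolynomial.aeval_X, MvPolynomial.constantCoeff_X, mul_zero, map_zero,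
      Algebra.smul_def]
    ring

/-- The nonunital algebra generated by `X` consists of the values at elements of `X` of
polynomials without constant term. -/
theorem mem_adjoin_iff_exists_aeval (X : Set A) (a : A) :
    a ∈ NonUnitalAlgebra.adjoin K X ↔ ∃ P : MvPolynomial X K,
      MvPolynomial.constantCoeff P = 0 ∧ MvPolynomial.aeval (fun x : X => (x : A)) P = a := by
  constructor
  · intro ha
    induction ha using NonUnitalAlgebra.adjoin_induction with
    | mem x hx => exact ⟨MvPolynomial.X ⟨x, hx⟩, by simp, by simp⟩
    | zero => exact ⟨0, by simp, by simp⟩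
    | add x y _ _ hx hy =>
      obtain ⟨P, hP, rfl⟩ := hx
      obtain ⟨Q, hQ, rfl⟩ := hy
      exact ⟨P + Q, by simp [hP, hQ], by simp⟩
    | mul x y _ _ hx hy =>
      obtain ⟨P, hP, rfl⟩ := hx
      obtain ⟨Q, hQ, rfl⟩ := hy
      exact ⟨P * Q, by simp [hP], by simp⟩
    | smul r x _ hx =>
      obtain ⟨P, hP, rfl⟩ := hx
      exact ⟨r • P, by simp [MvPolynomial.smul_eq_C_mul, hP], by simp⟩
  · rintro ⟨P, hP, rfl⟩
    simpa [hP] using aeval_sub_constantCoeff_mem_adjoin X P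

end Polynomials

/-- A nonunital real algebra with at least `κ > 𝔠` elements cannot be generated by fewer than `κ`
elements. -/
theorem le_mk_of_le_mk_adjoin {A : Type} [CommRing A] [Algebra ℝ A] {κ : Cardinal.{0}}
    (hκ : 𝔠 < κ) (Y : Set A) (h : κ ≤ #(NonUnitalAlgebra.adjoin ℝ Y)) : κ ≤ #Y := by
  have h₁ : #(NonUnitalAlgebra.adjoin ℝ Y) ≤ #(Algebra.adjoin ℝ Y) :=
    Cardinal.mk_le_mk_of_subset (NonUnitalAlgebra.adjoin_le
      (S := (Algebra.adjoin ℝ Y).toNonUnitalSubalgebra) Algebra.subset_adjoin)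
  have h₂ := h.trans (h₁.trans (Algebra.cardinalMk_adjoin_le ℝ Y))
  rw [Cardinal.mk_real] at h₂
  by_contra hY
  rw [not_le] at hY
  exact absurd h₂ (not_le.2 (max_lt (max_lt hκ hY) (Cardinal.aleph0_lt_continuum.trans hκ)))

section Bernstein

theorem exists_injective_mem_of_mk_le {ι α : Type u} (S : ι → Set α) (hS : ∀ i, #ι ≤ #(S i)) :
    ∃ x : ι → α, Function.Injective x ∧ ∀ i, x i ∈ S i := by
  obtain ⟨r, hr, hord⟩ := Cardinal.exists_ord_eq ι
  have key : ∀ (i : ι) (g : ∀ j, r j i → α), ∃ a ∈ S i, ∀ j (h : r j i), a ≠ g j h := by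
    intro i g
    by_contra! hcon
    have hsub : S i ⊆ Set.range fun j : {j // r j i} => g j.1 j.2 := by
      intro a ha
      obtain ⟨j, h, e⟩ := hcon a ha
      exact ⟨⟨j, h⟩, e.symm⟩
    have h₁ : #(S i) ≤ #{j // r j i} := (Cardinal.mk_le_mk_of_subset hsub).trans mk_range_le
    have h₂ : #{j // r j i} < #ι := Cardinal.card_typein_lt i hord
    exact absurd ((hS i).trans h₁) (not_le.2 h₂)
  choose c hcS hcne using key
  have hwf : WellFounded r := hr.wf
  let x : ι → α := hwf.fix c
  have hx : ∀ i, x i = c i fun j _ => x j := fun i => hwf.fix_eq c i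
  have hlt : ∀ i j, r j i → x i ≠ x j := fun i j h => by
    rw [hx i]
    exact hcne i (fun j _ => x j) j h
  refine ⟨x, fun i j hij => ?_, fun i => hx i ▸ hcS i _⟩
  by_contra hne
  rcases trichotomous_of r i j with h | h | h
  · exact hlt j i h hij.symm
  · exact hne h
  · exact hlt i j h hij

theorem mk_isCompact_real_le : #{C : Set ℝ // IsCompact C} ≤ 𝔠 := by
  have h := MeasurableSpace.cardinal_measurableSet_le_continuum
    (s := TopologicalSpace.countableBasis ℝ)
    ((TopologicalSpace.countable_countableBasis ℝ).le_aleph0.trans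
      Cardinal.aleph0_le_continuum)
  refine le_trans (Cardinal.mk_le_mk_of_subset ?_) h
  intro C hC
  have := (show IsCompact C from hC).measurableSet
  rwa [BorelSpace.measurable_eq (α := ℝ),
    (TopologicalSpace.isBasis_countableBasis ℝ).borel_eq_generateFrom] at this

theorem continuum_le_mk_of_isCompact {C : Set ℝ} (hC : IsCompact C) (hunc : ¬ C.Countable) :
    𝔠 ≤ #C := by
  obtain ⟨f, hf, -, hinj⟩ := hC.isClosed.exists_nat_bool_injection_of_not_countable hunc
  have h : #(ℕ → Bool) ≤ #C := Cardinal.mk_le_of_injective (f := fun y => ⟨f y, hf ⟨y, rfl⟩⟩)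
    fun a b hab => hinj (congrArg Subtype.val hab)
  simpa using h

/-- The line can be coloured by continuum many colours so that each uncountable compact set
contains points of every colour. -/
theorem exists_coloring {I : Type} [Nonempty I] (hI : #I ≤ 𝔠) :
    ∃ φ : ℝ → I, ∀ C : Set ℝ, IsCompact C → ¬ C.Countable → ∀ i, ∃ x ∈ C, φ x = i := by
  let J := {C : {C : Set ℝ // IsCompact C} // ¬ C.1.Countable} × I
  have hJ : #J ≤ 𝔠 := by
    rw [Cardinal.mk_prod, Cardinal.lift_id, Cardinal.lift_id]
    refine (mul_le_mul' ((Cardinal.mk_subtype_le _).trans mk_isCompact_real_le) hI).trans ?_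
    rw [Cardinal.continuum_mul_self]
  obtain ⟨x, hinj, hx⟩ := exists_injective_mem_of_mk_le (fun j : J => j.1.1.1)
    fun j => hJ.trans (continuum_le_mk_of_isCompact j.1.1.2 j.1.2)
  classical
  refine ⟨fun t => if h : ∃ j, x j = t then h.choose.2 else Classical.arbitrary I,
    fun C hC hunc i => ?_⟩
  let j : J := (⟨⟨C, hC⟩, hunc⟩, i)
  refine ⟨x j, hx j, ?_⟩
  have h : ∃ k, x k = x j := ⟨j, rfl⟩
  simp only [dif_pos h, hinj h.choose_spec, j]

theorem exists_finset_separating {α : Type*} [DecidableEq α] (V : Finset (Set α)) :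
    ∃ F : Finset α, ∀ A ∈ V, ∀ B ∈ V, (∀ t ∈ F, t ∈ A ↔ t ∈ B) → A = B := by
  classical
  have h : ∀ p : Set α × Set α, ∃ F : Finset α, (∀ t ∈ F, t ∈ p.1 ↔ t ∈ p.2) → p.1 = p.2 := by
    rintro ⟨A, B⟩
    by_cases hAB : A = B
    · exact ⟨∅, fun _ => hAB⟩
    · obtain ⟨t, ht⟩ : ∃ t, ¬ (t ∈ A ↔ t ∈ B) := by
        by_contra! hcon
        exact hAB (Set.ext hcon)
      exact ⟨{t}, fun h => absurd (h t (by simp)) ht⟩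
  choose G hG using h
  refine ⟨(V ×ˢ V).biUnion G, fun A hA B hB hAB => hG (A, B) fun t ht => hAB t ?_⟩
  exact Finset.mem_biUnion.2 ⟨(A, B), Finset.mem_product.2 ⟨hA, hB⟩, ht⟩

/-- A family of `2 ^ 𝔠` real functions any finitely many of which take any prescribed values
simultaneously on each uncountable compact set. -/
theorem exists_independent_family :
    ∃ H : Set ℝ → ℝ → ℝ, ∀ C : Set ℝ, IsCompact C → ¬ C.Countable →
      ∀ (V : Finset (Set ℝ)) (y : Set ℝ → ℝ), ∃ x ∈ C, ∀ A ∈ V, H A x = y A := by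
  classical
  have hI : #(Finset ℝ × (Finset ℝ →₀ ℝ)) ≤ 𝔠 := by
    simp [Cardinal.mk_real]
  obtain ⟨φ, hφ⟩ := exists_coloring hI
  let tr : Set ℝ → Finset ℝ → Finset ℝ := fun A F => F.filter (· ∈ A)
  refine ⟨fun A x => (φ x).2 (tr A (φ x).1), fun C hC hunc V y => ?_⟩
  obtain ⟨F, hF⟩ := exists_finset_separating V
  have hinj : ∀ A ∈ V, ∀ B ∈ V, tr A F = tr B F → A = B := by
    intro A hA B hB h
    refine hF A hA B hB fun t ht => ?_
    have := congrArg (t ∈ ·) h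
    simpa [tr, ht] using this
  let w : Finset ℝ → ℝ := fun G => if h : ∃ A ∈ V, tr A F = G then y h.choose else 0
  have hw : ∀ A ∈ V, w (tr A F) = y A := by
    intro A hA
    have h : ∃ B ∈ V, tr B F = tr A F := ⟨A, hA, rfl⟩
    have e : h.choose = A := hinj _ h.choose_spec.1 A hA h.choose_spec.2
    simp only [w]
    rw [dif_pos h, e]
  let ψ : Finset ℝ →₀ ℝ := Finsupp.onFinset (V.image fun A => tr A F) w fun G hG => by
    by_contra hne
    refine hG (dif_neg ?_)
    rintro ⟨A, hA, e⟩
    exact hne (Finset.mem_image.2 ⟨A, hA, e⟩)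
  obtain ⟨x, hxC, hx⟩ := hφ C hC hunc (F, ψ)
  refine ⟨x, hxC, fun A hA => ?_⟩
  simp only [hx]
  exact hw A hA

end Bernstein

section RichFamilies

/-- The functions in `X` have values in `T`, and any finitely many of them take any prescribed
values in `T` simultaneously on each uncountable compact set. -/
def IsRichFamily (T : Set ℝ) (X : Set (ℝ → ℝ)) : Prop :=
  (∀ f ∈ X, ∀ x, f x ∈ T) ∧ ∀ C : Set ℝ, IsCompact C → ¬ C.Countable →
    ∀ (V : Finset X) (y : X → ℝ), (∀ f, y f ∈ T) → ∃ x ∈ C, ∀ f ∈ V, f.1 x = y f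

theorem not_countable_of_mem_nhds {C : Set ℝ} {x : ℝ} (hC : C ∈ 𝓝 x) : ¬ C.Countable :=
  fun h => not_le.2 Cardinal.aleph0_lt_continuum
    (Cardinal.mk_real ▸ cardinal_eq_of_mem_nhds ℝ hC ▸ h.le_aleph0)

theorem not_countable_Icc {a b : ℝ} (hab : a < b) : ¬ (Set.Icc a b).Countable :=
  not_countable_of_mem_nhds (x := (a + b) / 2)
    (Icc_mem_nhds (by linarith) (by linarith))

theorem exists_isRichFamily {T : Set ℝ} (hT : T.Nontrivial) :
    ∃ X : Set (ℝ → ℝ), #X = 2 ^ 𝔠 ∧ IsRichFamily T X := by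
  classical
  obtain ⟨H, hH⟩ := exists_independent_family
  obtain ⟨a, ha, b, hb, hab⟩ := hT
  let g : ℝ → ℝ := fun t => if t ∈ T then t else a
  have hgT : ∀ t, g t ∈ T := fun t => by
    by_cases h : t ∈ T
    · simp [g, h]
    · simpa [g, h] using ha
  have hg : ∀ t ∈ T, g t = t := fun t h => by simp [g, h]
  let f : Set ℝ → ℝ → ℝ := fun A x => g (H A x)
  have hf : Function.Injective f := by
    intro A B hAB
    by_contra hne
    obtain ⟨x, -, hx⟩ := hH (Set.Icc 0 1) isCompact_Icc (not_countable_Icc one_pos) {A, B}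
      fun D => if D = A then a else b
    have hA := hx A (by simp)
    have hB := hx B (by simp)
    rw [if_pos rfl] at hA
    rw [if_neg (Ne.symm hne)] at hB
    have := congrFun hAB x
    simp only [f, hA, hB, hg a ha, hg b hb] at this
    exact hab this
  refine ⟨Set.range f, ?_, ?_, fun C hC hunc V y hy => ?_⟩
  · rw [Cardinal.mk_range_eq f hf, Cardinal.mk_set, Cardinal.mk_real]
  · rintro _ ⟨A, rfl⟩ x
    exact hgT _
  · choose s hs using fun F : Set.range f => F.2
    obtain ⟨x, hxC, hx⟩ := hH C hC hunc (V.image s) fun A => y ⟨f A, A, rfl⟩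
    refine ⟨x, hxC, fun F hF => ?_⟩
    have h₁ := hx (s F) (Finset.mem_image_of_mem s hF)
    have h₂ : (⟨f (s F), s F, rfl⟩ : Set.range f) = F := Subtype.ext (hs F)
    rw [h₂] at h₁
    rw [← hs F]
    simp only [f, h₁, hg _ (hy F)]

theorem aeval_apply_eq_eval (X : Set (ℝ → ℝ)) (P : MvPolynomial X ℝ) (x : ℝ) :
    MvPolynomial.aeval (fun f : X => (f : ℝ → ℝ)) P x
      = MvPolynomial.eval (fun f : X => f.1 x) P := by
  induction P using MvPolynomial.induction_on with
  | C a => simp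
  | add p q hp hq => simp [hp, hq]
  | mul_X p i hp => simp [hp]

theorem IsRichFamily.image_aeval_eq {T : Set ℝ} {X : Set (ℝ → ℝ)} (hX : IsRichFamily T X)
    (P : MvPolynomial X ℝ) {C : Set ℝ} (hC : IsCompact C) (hunc : ¬ C.Countable) :
    MvPolynomial.aeval (fun f : X => (f : ℝ → ℝ)) P '' C
      = (fun y => MvPolynomial.eval y P) '' Set.pi Set.univ fun _ : X => T := by
  ext z
  constructor
  · rintro ⟨x, -, rfl⟩
    exact ⟨fun f => f.1 x, fun f _ => hX.1 f.1 f.2 x, (aeval_apply_eq_eval X P x).symm⟩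
  · rintro ⟨y, hy, rfl⟩
    obtain ⟨x, hxC, hx⟩ := hX.2 C hC hunc P.vars y fun f => hy f trivial
    refine ⟨x, hxC, ?_⟩
    rw [aeval_apply_eq_eval]
    exact MvPolynomial.eval₂Hom_congr' rfl (fun i hi _ => hx i hi) rfl

theorem IsRichFamily.aeval_apply_mem {T : Set ℝ} {X : Set (ℝ → ℝ)} (hX : IsRichFamily T X)
    (P : MvPolynomial X ℝ) (x : ℝ) :
    MvPolynomial.aeval (fun f : X => (f : ℝ → ℝ)) P x
      ∈ (fun y => MvPolynomial.eval y P) '' Set.pi Set.univ fun _ : X => T :=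
  ⟨fun f => f.1 x, fun f _ => hX.1 f.1 f.2 x, (aeval_apply_eq_eval X P x).symm⟩

/-- A nonconstant function with the same image on all uncountable compact sets is nowhere
continuous. -/
theorem nowhereContinuous_of_image_eq {f : ℝ → ℝ} {T : Set ℝ} (hT : T.Nontrivial)
    (h : ∀ C : Set ℝ, IsCompact C → ¬ C.Countable → f '' C = T) : NowhereContinuous f := by
  intro x hx
  obtain ⟨v, hvT, hv⟩ := hT.exists_ne (f x)
  obtain ⟨ε, hε, hball⟩ := Metric.nhds_basis_closedBall.mem_iff.1
    (hx.preimage_mem_nhds (isOpen_ne.mem_nhds hv.symm))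
  rw [← h _ (isCompact_closedBall x ε)
    (not_countable_of_mem_nhds (Metric.closedBall_mem_nhds x hε))] at hvT
  obtain ⟨t, ht, htv⟩ := hvT
  exact hball ht htv

theorem IsRichFamily.nowhereContinuous {T : Set ℝ} (h0 : (0 : ℝ) ∈ T) {X : Set (ℝ → ℝ)}
    (hX : IsRichFamily T X) {P : MvPolynomial X ℝ} (hP : MvPolynomial.constantCoeff P = 0)
    (hne : MvPolynomial.aeval (fun f : X => (f : ℝ → ℝ)) P ≠ 0) :
    NowhereContinuous (MvPolynomial.aeval (fun f : X => (f : ℝ → ℝ)) P) := by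
  refine nowhereContinuous_of_image_eq ?_ fun C hC hunc => hX.image_aeval_eq P hC hunc
  obtain ⟨x, hx⟩ := Function.ne_iff.1 hne
  refine ⟨_, hX.aeval_apply_mem P x, 0, ⟨fun _ => 0, fun _ _ => h0, ?_⟩, hx⟩
  exact (congrFun (congrArg DFunLike.coe (MvPolynomial.eval_zero' (σ := X) (R := ℝ))) P).trans hP

theorem isDarboux_of_image_eq {f : ℝ → ℝ} {T : Set ℝ} (hT : IsConnected T)
    (hf : ∀ x, f x ∈ T) (h : ∀ C : Set ℝ, IsCompact C → ¬ C.Countable → f '' C = T) :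
    IsDarboux f := by
  intro C hC
  rcases C.subsingleton_or_nontrivial with hs | hn
  · exact ⟨hC.nonempty.image f, (hs.image f).isPreconnected⟩
  · obtain ⟨a, ha, b, hb, hab⟩ := hn.exists_lt
    have hsub : Set.Icc a b ⊆ C := hC.isPreconnected.Icc_subset ha hb
    have : f '' C = T := by
      refine Set.Subset.antisymm (Set.image_subset_iff.2 fun x _ => hf x) ?_
      rw [← h _ isCompact_Icc (not_countable_Icc hab)]
      exact Set.image_mono hsub
    rwa [this]

end RichFamilies

theorem isStronglyAlgebrable_darboux :
    IsStronglyAlgebrable ℝ ((2 : Cardinal.{0}) ^ Cardinal.continuum.{0})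
      {f : ℝ → ℝ | NowhereContinuous f ∧ IsDarboux f ∧ UncountableCompactPreserving f} := by
  have hinf : (Set.Icc (0 : ℝ) 1).Infinite := Set.Icc_infinite one_pos
  have h0 : (0 : ℝ) ∈ Set.Icc (0 : ℝ) 1 := ⟨le_rfl, zero_le_one⟩
  obtain ⟨X, hcard, hX⟩ := exists_isRichFamily hinf.nontrivial
  refine ⟨NonUnitalAlgebra.adjoin ℝ X, ?_, X, hcard, rfl, ?_⟩
  · intro g hg
    obtain ⟨P, hP, rfl⟩ := (mem_adjoin_iff_exists_aeval X g).1 hg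
    refine or_iff_not_imp_right.2 fun hne => ?_
    have hcont : Continuous fun y : X → ℝ => MvPolynomial.eval y P := MvPolynomial.continuous_eval P
    refine ⟨hX.nowhereContinuous h0 hP hne, ?_, fun C hC hunc => ?_⟩
    · refine isDarboux_of_image_eq ?_ (hX.aeval_apply_mem P)
        fun C hC hunc => hX.image_aeval_eq P hC hunc
      refine IsConnected.image ?_ _ hcont.continuousOn
      exact (convex_pi fun _ _ => convex_Icc 0 1).isConnected ⟨fun _ => 0, fun _ _ => h0⟩
    · rw [hX.image_aeval_eq P hC hunc]
      exact (isCompact_univ_pi fun _ => isCompact_Icc).image hcont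
  · intro P _ hP
    refine MvPolynomial.funext_set (fun _ => Set.Icc 0 1) (fun _ => hinf) fun y hy => ?_
    have hmem : MvPolynomial.eval y P ∈ MvPolynomial.aeval (fun f : X => (f : ℝ → ℝ)) P ''
        Set.Icc 0 1 := by
      rw [hX.image_aeval_eq P isCompact_Icc (not_countable_Icc one_pos)]
      exact ⟨y, hy, rfl⟩
    rw [hP] at hmem
    obtain ⟨_, -, h⟩ := hmem
    rw [← h, map_zero]
    rfl

theorem isAlgebrable_compactPreserving :
    IsAlgebrable ℝ ((2 : Cardinal.{0}) ^ Cardinal.continuum.{0})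
      {f : ℝ → ℝ | NowhereContinuous f ∧ CompactPreserving f} := by
  have hT : ({0, 1} : Set ℝ).Nontrivial := Set.nontrivial_pair zero_ne_one
  obtain ⟨X, hcard, hX⟩ := exists_isRichFamily hT
  have hfin : ∀ g ∈ NonUnitalAlgebra.adjoin ℝ X, (Set.range g).Finite := by
    intro g hg
    induction hg using NonUnitalAlgebra.adjoin_induction with
    | mem f hf =>
      refine (Set.toFinite ({0, 1} : Set ℝ)).subset ?_
      rintro _ ⟨x, rfl⟩
      exact hX.1 f hf x
    | zero => exact (Set.finite_singleton (0 : ℝ)).subset (by rintro _ ⟨x, rfl⟩; rfl)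
    | add f g _ _ hf hg =>
      refine (hf.image2 (· + ·) hg).subset ?_
      rintro _ ⟨x, rfl⟩
      exact ⟨f x, ⟨x, rfl⟩, g x, ⟨x, rfl⟩, rfl⟩
    | mul f g _ _ hf hg =>
      refine (hf.image2 (· * ·) hg).subset ?_
      rintro _ ⟨x, rfl⟩
      exact ⟨f x, ⟨x, rfl⟩, g x, ⟨x, rfl⟩, rfl⟩
    | smul r f _ hf =>
      refine (hf.image (r • ·)).subset ?_
      rintro _ ⟨x, rfl⟩
      exact ⟨f x, ⟨x, rfl⟩, rfl⟩
  refine ⟨NonUnitalAlgebra.adjoin ℝ X, ?_, ⟨X, hcard, rfl⟩, fun Y hY => ?_⟩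
  · intro g hg
    refine or_iff_not_imp_right.2 fun hne => ⟨?_, fun C _ => ?_⟩
    · obtain ⟨P, hP, rfl⟩ := (mem_adjoin_iff_exists_aeval X g).1 hg
      exact hX.nowhereContinuous (by simp) hP hne
    · exact ((hfin g hg).subset (Set.image_subset_range g C)).isCompact
  · refine le_mk_of_le_mk_adjoin (Cardinal.cantor 𝔠) Y ?_
    rw [hY, ← hcard]
    exact Cardinal.mk_le_mk_of_subset (NonUnitalAlgebra.subset_adjoin ℝ)

/-- Away from its value at a point, a compact-preserving function takes only finitely many values
near this point. -/
theorem CompactPreserving.exists_finite_image_diff_ball {f : ℝ → ℝ} (hf : CompactPreserving f)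
    (x : ℝ) {ε : ℝ} (hε : 0 < ε) : ∃ U ∈ 𝓝 x, (f '' U \ Metric.ball (f x) ε).Finite := by
  classical
  by_contra! hcon
  obtain ⟨p, hp, hpr⟩ := exists_seq_of_forall_finset_exists
    (fun q : ℕ × ℝ => q.2 ∈ Metric.ball x (1 / ((q.1 : ℝ) + 1)) ∧ f q.2 ∉ Metric.ball (f x) ε)
    (fun q r => q.1 < r.1 ∧ f q.2 ≠ f r.2) (by
      intro s _
      let n := s.sup Prod.fst + 1
      obtain ⟨_, ⟨⟨y, hy, rfl⟩, hyb⟩, hys⟩ :=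
        (hcon _ (Metric.ball_mem_nhds x (Nat.one_div_pos_of_nat (n := n)))).exists_notMem_finset
          (s.image fun q => f q.2)
      refine ⟨(n, y), ⟨hy, hyb⟩, fun q hq => ⟨Nat.lt_succ_of_le (Finset.le_sup hq), fun e => ?_⟩⟩
      exact hys (Finset.mem_image.2 ⟨q, hq, e⟩))
  have hmono : StrictMono fun n => (p n).1 := fun m n h => (hpr m n h).1
  have hu : Tendsto (fun n => (p n).2) atTop (𝓝 x) := by
    rw [tendsto_iff_dist_tendsto_zero]
    refine squeeze_zero (fun _ => dist_nonneg) (fun n => (Metric.mem_ball.1 (hp n).1).le) ?_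
    exact tendsto_one_div_add_atTop_nhds_zero_nat.comp hmono.tendsto_atTop
  obtain ⟨y, -, φ, hφ, hlim⟩ := (hf _ hu.isCompact_insert_range).tendsto_subseq
    (x := fun n => f (p n).2) fun n => ⟨_, Or.inr ⟨n, rfl⟩, rfl⟩
  have hy : y ∉ Metric.ball (f x) ε :=
    Metric.isOpen_ball.isClosed_compl.mem_of_tendsto hlim (Eventually.of_forall fun n => (hp _).2)
  have htail : ∀ m, ∃ n, y = f (p (φ (n + m))).2 := by
    intro m
    have hshift : Tendsto (fun n => φ (n + m)) atTop atTop :=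
      hφ.tendsto_atTop.comp (tendsto_add_atTop_nat m)
    have hmem := (hf _ (hu.comp hshift).isCompact_insert_range).isClosed.mem_of_tendsto
      (hlim.comp (tendsto_add_atTop_nat m))
      (Eventually.of_forall fun n => ⟨_, Or.inr ⟨n, rfl⟩, rfl⟩)
    obtain ⟨t, rfl | ⟨n, rfl⟩, ht⟩ := hmem
    · exact absurd (ht ▸ Metric.mem_ball_self hε) hy
    · exact ⟨n, ht.symm⟩
  obtain ⟨n, hn⟩ := htail 0
  obtain ⟨k, hk⟩ := htail (n + 1)
  exact (hpr (φ (n + 0)) (φ (k + (n + 1))) (hφ (by omega))).2 (hn.symm.trans hk)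

/-- A compact-preserving function with a point of discontinuity takes only finitely many values
on some nonempty open set. -/
theorem CompactPreserving.exists_finite_image {f : ℝ → ℝ} (hf : CompactPreserving f)
    {x : ℝ} (hx : ¬ ContinuousAt f x) : ∃ y, ∃ U ∈ 𝓝 y, (f '' U).Finite := by
  simp only [Metric.continuousAt_iff', not_forall] at hx
  obtain ⟨ε, hε, hx⟩ := hx
  obtain ⟨U, hU, hUfin⟩ := hf.exists_finite_image_diff_ball x (half_pos hε)
  obtain ⟨y, hy, hyU⟩ := ((not_eventually.1 hx).and_eventually
    (eventually_mem_nhds_iff.2 hU)).exists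
  obtain ⟨W, hW, hWfin⟩ := hf.exists_finite_image_diff_ball y (half_pos hε)
  refine ⟨y, U ∩ W, inter_mem hyU hW, (hUfin.union hWfin).subset ?_⟩
  rintro _ ⟨t, ⟨htU, htW⟩, rfl⟩
  by_cases h : f t ∈ Metric.ball (f x) (ε / 2)
  · refine Or.inr ⟨⟨t, htW, rfl⟩, fun h' => hy ?_⟩
    rw [Metric.mem_ball] at h h'
    linarith [dist_triangle_left (f y) (f x) (f t)]
  · exact Or.inl ⟨⟨t, htU, rfl⟩, h⟩

theorem not_isStronglyAlgebrable_compactPreserving :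
    ¬ IsStronglyAlgebrable ℝ 1 {f : ℝ → ℝ | NowhereContinuous f ∧ CompactPreserving f} := by
  rintro ⟨B, hB, X, hX, rfl, hfree⟩
  obtain ⟨f, rfl⟩ := Cardinal.mk_set_eq_one_iff.1 hX
  let i : ({f} : Set (ℝ → ℝ)) := ⟨f, rfl⟩
  have key : ∀ P : MvPolynomial ({f} : Set (ℝ → ℝ)) ℝ, MvPolynomial.constantCoeff P = 0 → P ≠ 0 →
      MvPolynomial.aeval (fun g : ({f} : Set (ℝ → ℝ)) => (g : ℝ → ℝ)) P ∈
        {f : ℝ → ℝ | NowhereContinuous f ∧ CompactPreserving f} := fun P hP hne =>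
    (hB ((mem_adjoin_iff_exists_aeval _ _).2 ⟨P, hP, rfl⟩)).resolve_right
      fun h => hne (hfree P hP h)
  have hf := key (MvPolynomial.X i) (by simp) (MvPolynomial.X_ne_zero i)
  rw [MvPolynomial.aeval_X] at hf
  obtain ⟨y, U, hU, hfin⟩ := hf.2.exists_finite_image (hf.1 0)
  let Q : MvPolynomial ({f} : Set (ℝ → ℝ)) ℝ :=
    MvPolynomial.X i * ∏ v ∈ hfin.toFinset, (MvPolynomial.X i - MvPolynomial.C v)
  have hQ : Q ≠ 0 := by
    refine mul_ne_zero (MvPolynomial.X_ne_zero i) (Finset.prod_ne_zero_iff.2 fun v _ h => ?_)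
    have := congrArg (MvPolynomial.eval fun _ => v + 1) h
    simp at this
  refine (key Q (by simp [Q]) hQ).1 y ?_
  refine (continuousAt_const (y := (0 : ℝ))).congr ?_
  filter_upwards [hU] with t ht
  rw [aeval_apply_eq_eval]
  have hprod : ∏ v ∈ hfin.toFinset, (f t - v) = 0 :=
    Finset.prod_eq_zero (i := f t) (hfin.mem_toFinset.2 ⟨t, ht, rfl⟩) (sub_self _)
  simp [Q, i, map_prod, hprod]

theorem mainTheorem11 :
    IsStronglyAlgebrable ℝ ((2 : Cardinal.{0}) ^ Cardinal.continuum.{0})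
        {f : ℝ → ℝ | NowhereContinuous f ∧ IsDarboux f ∧ UncountableCompactPreserving f} ∧
      IsAlgebrable ℝ ((2 : Cardinal.{0}) ^ Cardinal.continuum.{0})
        {f : ℝ → ℝ | NowhereContinuous f ∧ CompactPreserving f} ∧
      ¬ IsStronglyAlgebrable ℝ 1
        {f : ℝ → ℝ | NowhereContinuous f ∧ CompactPreserving f} :=
  ⟨isStronglyAlgebrable_darboux, isAlgebrable_compactPreserving,
    not_isStronglyAlgebrable_compactPreserving⟩
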